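/- The rings $\mathbb{Z}[\sqrt{-3}]$ and $\mathbb{Z}[\sqrt{-7}]$ are projective-free: if $O$ is either of these two rings, then every finitely generated projective $O$-module is free. -/

import Mathlib

/-! Let `I` be the conductor of `O`, i.e. `2` times the maximal order. Ideals not inside `I` are
principal, by a Euclidean argument on an element of least norm. A nonzero projective `M` has a
functional whose image is not inside `I`; the image is then free of rank one, so `O` splits off `M`,
and induction on the rank finishes. -/

theorem exists_range_not_le_of_projective {R M : Type*} [CommRing R] [IsDomain R]
    [AddCommGroup M] [Module R M] [Module.Finite R M] [Module.Projective R M] [Nontrivial M]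
    {I : Ideal R} (hI : I ≠ ⊤) : ∃ φ : M →ₗ[R] R, ¬ LinearMap.range φ ≤ I := by
  by_contra! h
  obtain ⟨n, f, g, -, -, hfg⟩ := Module.Finite.exists_comp_eq_id_of_projective R M
  -- The dual basis gives `M = IM`; by Nakayama some `r ≡ 1` mod `I` kills the torsion-free `M`.
  have hle : (⊤ : Submodule R M) ≤ I • ⊤ := by
    intro m _
    have hm : m = ∑ i, g m i • f (Pi.single i 1) := by
      conv_lhs => rw [← LinearMap.id_apply (R := R) m, ← hfg, LinearMap.comp_apply,
        ← Finset.univ_sum_single (g m), map_sum]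
      refine Finset.sum_congr rfl fun i _ => ?_
      rw [← map_smul, ← Pi.single_smul, smul_eq_mul, mul_one]
    rw [hm]
    exact Submodule.sum_mem _ fun i _ => Submodule.smul_mem_smul
      (h (LinearMap.proj i ∘ₗ g) ⟨m, rfl⟩) Submodule.mem_top
  obtain ⟨r, hr, hr0⟩ := Submodule.exists_sub_one_mem_and_smul_eq_zero_of_fg_of_le_smul I ⊤
    Module.Finite.fg_top hle
  obtain ⟨m, hm⟩ := exists_ne (0 : M)
  have : r = 0 := (smul_eq_zero.1 (hr0 m trivial)).resolve_right hm
  apply hI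
  rw [Ideal.eq_top_iff_one]
  simpa [this] using hr

theorem exists_surjective_of_projective {R M : Type*} [CommRing R] [IsDomain R]
    [AddCommGroup M] [Module R M] [Module.Finite R M] [Module.Projective R M] [Nontrivial M]
    {I : Ideal R} (hI : I ≠ ⊤) (hprin : ∀ J : Ideal R, ¬ J ≤ I → J.IsPrincipal) :
    ∃ φ : M →ₗ[R] R, Function.Surjective φ := by
  obtain ⟨φ, hφ⟩ := exists_range_not_le_of_projective (M := M) hI
  obtain ⟨a, ha⟩ := hprin _ hφ
  have ha0 : a ≠ 0 := by
    rintro rfl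
    rw [ha] at hφ
    simp at hφ
  let e := (LinearEquiv.ofEq _ _ ha).trans (LinearEquiv.toSpanNonzeroSingleton R R a ha0).symm
  exact ⟨e.toLinearMap ∘ₗ φ.rangeRestrict, e.surjective.comp φ.surjective_rangeRestrict⟩

theorem Module.free_of_projective_of_isPrincipal {R : Type*} [CommRing R] [IsDomain R]
    {I : Ideal R} (hI : I ≠ ⊤) (hprin : ∀ J : Ideal R, ¬ J ≤ I → J.IsPrincipal)
    (M : Type*) [AddCommGroup M] [Module R M] [Module.Finite R M] [Module.Projective R M] :
    Module.Free R M := by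
  induction h : Module.finrank R M using Nat.strong_induction_on generalizing M with
  | _ n ih =>
    subst h
    cases subsingleton_or_nontrivial M
    · exact Module.Free.of_subsingleton R M
    obtain ⟨φ, hφ⟩ := exists_surjective_of_projective (M := M) hI hprin
    obtain ⟨g, hg⟩ := φ.exists_rightInverse_of_surjective (LinearMap.range_eq_top.2 hφ)
    let e := ((LinearMap.exact_subtype_ker_map φ).splitSurjectiveEquiv
      (Submodule.subtype_injective _) ⟨g, hg⟩).1
    have : Module.Finite R (LinearMap.ker φ) :=
      .of_surjective (LinearMap.fst R _ R ∘ₗ e.toLinearMap) (Prod.fst_surjective.comp e.surjective)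
    have : Module.Projective R (LinearMap.ker φ) :=
      have := Module.Projective.of_equiv e
      .of_split (LinearMap.inl R _ R) (LinearMap.fst R _ R) (LinearMap.fst_comp_inl _ _ _)
    have hrank : Module.finrank R (LinearMap.ker φ) < Module.finrank R M := by
      have h1 := (LinearMap.ker φ).finrank_quotient_add_finrank
      have h2 := (φ.quotKerEquivOfSurjective hφ).finrank_eq
      rw [Module.finrank_self] at h2
      omega
    have := ih _ hrank (LinearMap.ker φ) rfl
    exact Module.Free.of_equiv e.symm

/-- The unit disc about `0` and the discs of radius `1/2` about `√d/2` and `(1+√d)/2` cover this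
quarter cell. -/
theorem exists_lt_one_of_mem_Icc {d : ℤ} (hd : d = -3 ∨ d = -7) {a b : ℚ}
    (ha0 : 0 ≤ a) (ha : a ≤ 1 / 2) (hb0 : 0 ≤ b) (hb : b ≤ 1 / 2) :
    a ^ 2 - d * b ^ 2 < 1 ∨ (2 * a) ^ 2 - d * (2 * b - 1) ^ 2 < 1 ∨
      (2 * a - 1) ^ 2 - d * (2 * b - 1) ^ 2 < 1 := by
  by_contra! h
  obtain ⟨h1, h2, h3⟩ := h
  rcases hd with rfl | rfl
  · push_cast at *
    have hb' : b = 1 / 2 := by nlinarith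
    have ha' : a = 1 / 2 := by subst hb'; nlinarith
    subst hb' ha'
    norm_num at h3
  · push_cast at *
    -- One of `2a`, `1 - 2a` is at most `1/2`, so `7(1 - 2b)² ≥ 3/4`. The decimals below are rounded
    -- bounds, tightened alternately.
    have hc : 3 / 28 ≤ (1 - 2 * b) ^ 2 := by
      rcases le_total a (1 / 4) with h | h <;> nlinarith
    have hb1 : b ≤ 337 / 1000 := by nlinarith
    have ha1 : 45 / 100 ≤ a := by nlinarith
    have hb2 : b ≤ 32 / 100 := by nlinarith
    nlinarith

theorem exists_lt_one {d : ℤ} (hd : d = -3 ∨ d = -7) (a b : ℚ) :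
    (∃ m n : ℤ, (a - m) ^ 2 - d * (b - n) ^ 2 < 1) ∨
      ∃ m n : ℤ, (2 * a - m) ^ 2 - d * (2 * b - n) ^ 2 < 1 := by
  have key : ∀ c : ℚ, ∃ (k s : ℤ) (t : ℚ), 0 ≤ t ∧ t ≤ 1 / 2 ∧ (s : ℚ) ^ 2 = 1 ∧
      c = k + s * t := by
    intro c
    have h := abs_sub_round c
    rcases le_total 0 (c - round c) with h0 | h0
    · rw [abs_of_nonneg h0] at h
      exact ⟨round c, 1, _, h0, h, by norm_num, by push_cast; ring⟩
    · rw [abs_of_nonpos h0] at h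
      exact ⟨round c, -1, _, neg_nonneg.2 h0, h, by norm_num, by push_cast; ring⟩
  obtain ⟨k, s, t, ht0, ht, hs, rfl⟩ := key a
  obtain ⟨l, u, v, hv0, hv, hu, rfl⟩ := key b
  rcases exists_lt_one_of_mem_Icc hd ht0 ht hv0 hv with h | h | h
  · refine .inl ⟨k, l, lt_of_eq_of_lt ?_ h⟩
    linear_combination t ^ 2 * hs - d * v ^ 2 * hu
  · refine .inr ⟨2 * k, 2 * l + u, lt_of_eq_of_lt ?_ h⟩
    push_cast
    linear_combination 4 * t ^ 2 * hs - d * (2 * v - 1) ^ 2 * hu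
  · refine .inr ⟨2 * k + s, 2 * l + u, lt_of_eq_of_lt ?_ h⟩
    push_cast
    linear_combination (2 * t - 1) ^ 2 * hs - d * (2 * v - 1) ^ 2 * hu

namespace Zsqrtd

theorem isDomain_of_neg {d : ℤ} (hd : d < 0) : IsDomain (ℤ√d) :=
  have : NoZeroDivisors (ℤ√d) := ⟨fun {a b} h => by
    simpa [norm_mul, norm_eq_zero_iff hd] using congrArg norm h⟩
  have : Nontrivial (ℤ√d) := ⟨0, 1, by simp⟩
  NoZeroDivisors.to_isDomain _

/-- The ideal of elements `a + b√d` with `a ≡ b` modulo `2`. -/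
def evenIdeal {d : ℤ} (hd : Odd d) : Ideal (ℤ√d) where
  carrier := {z | Even (z.re - z.im)}
  zero_mem' := by simp
  add_mem' {a b} ha hb := by
    simp only [Set.mem_ofPred_eq, re_add, im_add] at *
    rw [add_sub_add_comm]
    exact ha.add hb
  smul_mem' c z hz := by
    obtain ⟨e, rfl⟩ := hd
    obtain ⟨k, hk⟩ := hz
    simp only [smul_eq_mul, Set.mem_ofPred_eq, re_mul, im_mul]
    exact ⟨k * (c.re - c.im) + e * c.im * z.im, by
      linear_combination (c.re - c.im) * hk⟩

theorem mem_evenIdeal {d : ℤ} {hd : Odd d} {z : ℤ√d} :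
    z ∈ evenIdeal hd ↔ Even (z.re - z.im) := Iff.rfl

theorem evenIdeal_ne_top {d : ℤ} (hd : Odd d) : evenIdeal hd ≠ ⊤ := by
  rw [Ne, Ideal.eq_top_iff_one, mem_evenIdeal]
  simp

theorem norm_sub_mul_lt {d : ℤ} (hd : d < 0) {x : ℤ√d} (hx : x ≠ 0) (y : ℤ√d) {m n : ℤ}
    (h : (((y * star x).re : ℚ) / x.norm - m) ^ 2 -
      d * (((y * star x).im : ℚ) / x.norm - n) ^ 2 < 1) :
    (y - x * ⟨m, n⟩).norm < x.norm := by
  have hpos : 0 < x.norm :=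
    (norm_nonneg hd.le x).lt_of_ne' fun h => hx ((norm_eq_zero_iff hd x).1 h)
  have hpos' : (0 : ℚ) < x.norm := mod_cast hpos
  have hne := hpos'.ne'
  have h1 : (y - x * ⟨m, n⟩).norm * x.norm =
      ((y * star x).re - m * x.norm) ^ 2 - d * ((y * star x).im - n * x.norm) ^ 2 := by
    simp only [norm_def, re_sub, im_sub, re_mul, im_mul, re_star, im_star]
    ring
  have h2 : ((y - x * ⟨m, n⟩).norm : ℚ) * x.norm = (x.norm : ℚ) ^ 2 *
      ((((y * star x).re : ℚ) / x.norm - m) ^ 2 -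
        d * (((y * star x).im : ℚ) / x.norm - n) ^ 2) := by
    rw [← Int.cast_mul, h1]
    push_cast
    field_simp
  have h3 : ((y - x * ⟨m, n⟩).norm : ℚ) * x.norm < x.norm * x.norm := by
    rw [h2]
    nlinarith [mul_pos hpos' hpos']
  exact_mod_cast lt_of_mul_lt_mul_right h3 hpos'.le

theorem exists_two_mul_eq_mul {d : ℤ} (hd : d = -3 ∨ d = -7) {J : Ideal (ℤ√d)} {x : ℤ√d}
    (hx : x ∈ J) (hx0 : x ≠ 0) (hmin : ∀ y ∈ J, y.norm < x.norm → y = 0) {y : ℤ√d}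
    (hy : y ∈ J) : ∃ w, 2 * y = x * w := by
  have hd0 : d < 0 := by omega
  rcases exists_lt_one hd (((y * star x).re : ℚ) / x.norm) (((y * star x).im : ℚ) / x.norm)
    with ⟨m, n, h⟩ | ⟨m, n, h⟩
  · have := hmin _ (J.sub_mem hy (J.mul_mem_right _ hx)) (norm_sub_mul_lt hd0 hx0 y h)
    exact ⟨2 * ⟨m, n⟩, by linear_combination 2 * this⟩
  · have := hmin _ (J.sub_mem (J.mul_mem_left 2 hy) (J.mul_mem_right _ hx))
      (norm_sub_mul_lt hd0 hx0 (2 * y) (m := m) (n := n) (by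
        convert h using 4
        · simp; ring
        · simp; ring))
    exact ⟨⟨m, n⟩, sub_eq_zero.1 this⟩

/-- If `w = 2q + 1`, then `y - xq = x/2` lies in `J` with a quarter of the minimal norm. Multiplying
by `√d` swaps the parities and excludes the other mixed case. -/
theorem even_re_sub_im_of_two_mul_eq {d : ℤ} (hd : d < 0) (hodd : Odd d) {J : Ideal (ℤ√d)}
    {x : ℤ√d} (hx : x ∈ J) (hx0 : x ≠ 0) (hmin : ∀ y ∈ J, y.norm < x.norm → y = 0)
    {y w : ℤ√d} (hy : y ∈ J) (hw : 2 * y = x * w) : Even (w.re - w.im) := by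
  have := isDomain_of_neg hd
  have key : ∀ y ∈ J, ∀ w, 2 * y = x * w → Odd w.re → ¬ Even w.im := by
    rintro y hy w hw ⟨k, hk⟩ ⟨l, hl⟩
    have h2 : 2 * (y - x * ⟨k, l⟩) = x := by
      have : w = 2 * ⟨k, l⟩ + 1 := by
        ext <;> simp [hk, hl]; ring
      linear_combination hw + x * this
    have hn : 4 * (y - x * ⟨k, l⟩).norm = x.norm := by
      conv_rhs => rw [← h2, norm_mul]
      simp [norm_def]
    have h0 := hmin (y - x * ⟨k, l⟩) (J.sub_mem hy (J.mul_mem_right _ hx)) (by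
      have hpos : 0 < x.norm :=
        (norm_nonneg hd.le x).lt_of_ne' fun h => hx0 ((norm_eq_zero_iff hd x).1 h)
      omega)
    rw [h0, mul_zero] at h2
    exact hx0 h2.symm
  rw [Int.even_sub]
  have h1 := key y hy w hw
  have h2 := key _ (J.mul_mem_left sqrtd hy) (sqrtd * w) (by linear_combination sqrtd * hw)
  simp only [re_mul, im_mul, re_sqrtd, im_sqrtd, zero_mul, one_mul, zero_add, mul_one,
    ← Int.not_even_iff_odd, Int.even_mul, Int.not_even_iff_odd.2 hodd, false_or] at h1 h2
  tauto

theorem isPrincipal_of_not_le_evenIdeal {d : ℤ} (hd : d = -3 ∨ d = -7) (hodd : Odd d)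
    (J : Ideal (ℤ√d)) (hJ : ¬ J ≤ evenIdeal hodd) : J.IsPrincipal := by
  have hd0 : d < 0 := by omega
  have := isDomain_of_neg hd0
  obtain ⟨x, ⟨hx, hx0⟩, hxmin⟩ := WellFounded.has_min
    (InvImage.wf (fun z : ℤ√d => z.norm.toNat) Nat.lt_wfRel.wf) {z | z ∈ J ∧ z ≠ 0} (by
      by_contra! h
      refine hJ fun z hz => ?_
      by_cases hz0 : z = 0
      · simp [hz0]
      · exact (h.subset ⟨hz, hz0⟩ : z ∈ (∅ : Set _)).elim)
  have hmin : ∀ y ∈ J, y.norm < x.norm → y = 0 := by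
    intro y hy h
    by_contra hy0
    refine hxmin y ⟨hy, hy0⟩ ?_
    have := norm_nonneg hd0.le y
    simp only [InvImage]
    change y.norm.toNat < x.norm.toNat
    omega
  by_cases hall : ∀ y ∈ J, ∀ w, 2 * y = x * w → Even w.im
  · refine ⟨x, _root_.le_antisymm (fun y hy => ?_) ((Ideal.span_singleton_le_iff_mem J).2 hx)⟩
    obtain ⟨w, hw⟩ := exists_two_mul_eq_mul hd hx hx0 hmin hy
    have h1 := even_re_sub_im_of_two_mul_eq hd0 hodd hx hx0 hmin hy hw
    have h2 := hall y hy w hw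
    obtain ⟨k, hk⟩ := (Int.even_sub.1 h1).2 h2
    obtain ⟨l, hl⟩ := h2
    refine Ideal.mem_span_singleton'.2 ⟨⟨k, l⟩, ?_⟩
    have hw' : w = 2 * ⟨k, l⟩ := by
      ext <;> simp [hk, hl] <;> ring
    apply mul_left_cancel₀ (two_ne_zero : (2 : ℤ√d) ≠ 0)
    rw [hw, hw']
    ring
  -- An odd `w₀` forces `x ∈ I`. Every `w` is in `I` too, so `xw` is `4` times an integer of the
  -- field and `y = xw/2` lies in `I`.
  · refine (hJ fun y hy => ?_).elim
    push Not at hall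
    obtain ⟨y₀, hy₀, w₀, hw₀, hw₀im⟩ := hall
    have hpar₀ := even_re_sub_im_of_two_mul_eq hd0 hodd hx hx0 hmin hy₀ hw₀
    obtain ⟨w, hw⟩ := exists_two_mul_eq_mul hd hx hx0 hmin hy
    obtain ⟨t, ht⟩ := even_re_sub_im_of_two_mul_eq hd0 hodd hx hx0 hmin hy hw
    have hxe : Even (x.re - x.im) := by
      have h := congrArg im hw₀
      have h' : 2 * y₀.im = x.re * w₀.im + x.im * w₀.re := by simpa using h
      have h3 : Even (x.re * w₀.im + x.im * w₀.re) := ⟨y₀.im, by rw [← h']; ring⟩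
      simp only [Int.even_add, Int.even_sub, Int.even_mul] at h3 hpar₀ ⊢
      tauto
    obtain ⟨s, hs⟩ := hxe
    obtain ⟨e, he⟩ : ∃ e, d = 4 * e + 1 := by
      rcases hd with rfl | rfl
      · exact ⟨-1, rfl⟩
      · exact ⟨-2, rfl⟩
    have hre : 2 * y.re = x.re * w.re + d * x.im * w.im := by simpa using congrArg re hw
    have him : 2 * y.im = x.re * w.im + x.im * w.re := by simpa using congrArg im hw
    refine mem_evenIdeal.2 ⟨s * t + e * x.im * w.im, ?_⟩
    refine mul_left_cancel₀ (two_ne_zero : (2 : ℤ) ≠ 0) ?_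
    linear_combination hre - him + (w.re - w.im) * hs + 2 * s * ht + x.im * w.im * he

end Zsqrtd

theorem Zsqrtd.free_of_projective {d : ℤ} (hd : d = -3 ∨ d = -7) (M : Type*) [AddCommGroup M]
    [Module (ℤ√d) M] [Module.Finite (ℤ√d) M] [Module.Projective (ℤ√d) M] :
    Module.Free (ℤ√d) M :=
  have := isDomain_of_neg (show d < 0 by omega)
  have hodd : Odd d := by rcases hd with rfl | rfl <;> decide
  Module.free_of_projective_of_isPrincipal (evenIdeal_ne_top hodd)
    (isPrincipal_of_not_le_evenIdeal hd hodd) M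

theorem mainTheorem10 :
    (∀ (M : Type*) [AddCommGroup M] [Module (Zsqrtd (-3)) M],
      Module.Finite (Zsqrtd (-3)) M → Module.Projective (Zsqrtd (-3)) M →
        Module.Free (Zsqrtd (-3)) M) ∧
    (∀ (M : Type*) [AddCommGroup M] [Module (Zsqrtd (-7)) M],
      Module.Finite (Zsqrtd (-7)) M → Module.Projective (Zsqrtd (-7)) M →
        Module.Free (Zsqrtd (-7)) M) := by
  exact ⟨fun M _ _ _ _ => Zsqrtd.free_of_projective (.inl rfl) M,
    fun M _ _ _ _ => Zsqrtd.free_of_projective (.inr rfl) M⟩
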